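/- Let $q\in\mathbb C$ be non-zero and not a root of unity. Let $A(SL_q(2))$ be the unital $\mathbb C$-algebra generated by $a,b,c,d$ with relations $$ab=q^{-1}ba,\quad ac=q^{-1}ca,\quad bd=q^{-1}db,\quad bc=cb,\quad cd=q^{-1}dc,$$ $$ad-da=(q^{-1}-q)bc,\quad ad-q^{-1}bc=da-qbc=1.$$ Let $\Delta_R:A(SL_q(2))\to A(SL_q(2))\otimes\mathbb C[z,z^{-1}]$ be the algebra homomorphism with $a\mapsto a\otimes z$, $b\mapsto b\otimes z^{-1}$, $c\mapsto c\otimes z$, $d\mapsto d\otimes z^{-1}$, and let $A(S_q^2)=\{p : \Delta_R(p)=p\otimes 1\}$ be the coordinate algebra of the standard Podleś quantum sphere. Put $\zeta=-q^{-1}bc\in A(S^2_q)$, and let $\tau^1:A(S_q^2)\to\mathbb C$ (the Chern cocycle) be the unique linear functional such that, for all integers $m,n\ge 0$, $$\tau^1\big((ab)^m\zeta^n\big)=\tau^1\big((cd)^m\zeta^n\big)=\begin{cases}(1-q^{2n})^{-1}& \text{if } n>0,\ m=0,\\ 0&\text{otherwise.}\end{cases}$$ For $0\le k\le n$ and $x=q^2$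 let $$\binom{n}{k}_{x}=\frac{(x-1)\cdots(x^n-1)}{(x-1)\cdots(x^k-1)\,(x-1)\cdots(x^{n-k}-1)}.$$ For $\mu\in\mathbb Z$ let $e_\mu\in M_{|\mu|+1}(A(S_q^2))$ be the left projector of the quantum Hopf line bundle of winding number $\mu$, that is, the matrix with entries, for $0\le k,l\le|\mu|$, $$(e_\mu)_{kl}=\begin{cases}a^{-\mu-k}c^{k}\binom{-\mu}{l}_{q^2}(-q)^l\,b^ld^{-\mu-l}&\text{if }\mu\le 0,\\[2pt] b^{k}d^{\mu-k}\binom{\mu}{l}_{q^2}(-q)^{-l}\,a^{\mu-l}c^l&\text{if }\mu\ge 0.\end{cases}$$ Then, for every $\mu\in\mathbb Z$, $(\tau^1\circ\mathrm{Tr})(e_\mu)=\mu$, where $\mathrm{Tr}$ is the usual matrix trace. -/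

import Mathlib

noncomputable section

namespace QuantumSphere

open scoped TensorProduct LaurentPolynomial

/-- The four generators of the coordinate algebra of `SL_q(2)`. -/
inductive Gen : Type
  | a | b | c | d

/-- The defining relations of the coordinate algebra of `SL_q(2)` over `ℂ`. -/
inductive Rel (q : ℂ) : FreeAlgebra ℂ Gen → FreeAlgebra ℂ Gen → Prop
  | ab : Rel q (FreeAlgebra.ι ℂ Gen.a * FreeAlgebra.ι ℂ Gen.b)
      (q⁻¹ • (FreeAlgebra.ι ℂ Gen.b * FreeAlgebra.ι ℂ Gen.a))
  | ac : Rel q (FreeAlgebra.ι ℂ Gen.a * FreeAlgebra.ι ℂ Gen.c)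
      (q⁻¹ • (FreeAlgebra.ι ℂ Gen.c * FreeAlgebra.ι ℂ Gen.a))
  | bd : Rel q (FreeAlgebra.ι ℂ Gen.b * FreeAlgebra.ι ℂ Gen.d)
      (q⁻¹ • (FreeAlgebra.ι ℂ Gen.d * FreeAlgebra.ι ℂ Gen.b))
  | bc : Rel q (FreeAlgebra.ι ℂ Gen.b * FreeAlgebra.ι ℂ Gen.c)
      (FreeAlgebra.ι ℂ Gen.c * FreeAlgebra.ι ℂ Gen.b)
  | cd : Rel q (FreeAlgebra.ι ℂ Gen.c * FreeAlgebra.ι ℂ Gen.d)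
      (q⁻¹ • (FreeAlgebra.ι ℂ Gen.d * FreeAlgebra.ι ℂ Gen.c))
  | ad_da : Rel q
      (FreeAlgebra.ι ℂ Gen.a * FreeAlgebra.ι ℂ Gen.d
        - FreeAlgebra.ι ℂ Gen.d * FreeAlgebra.ι ℂ Gen.a)
      ((q⁻¹ - q) • (FreeAlgebra.ι ℂ Gen.b * FreeAlgebra.ι ℂ Gen.c))
  | det_left : Rel q
      (FreeAlgebra.ι ℂ Gen.a * FreeAlgebra.ι ℂ Gen.d
        - q⁻¹ • (FreeAlgebra.ι ℂ Gen.b * FreeAlgebra.ι ℂ Gen.c)) 1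
  | det_right : Rel q
      (FreeAlgebra.ι ℂ Gen.d * FreeAlgebra.ι ℂ Gen.a
        - q • (FreeAlgebra.ι ℂ Gen.b * FreeAlgebra.ι ℂ Gen.c)) 1

/-- The coordinate algebra `A(SL_q(2))`. -/
def SLq2 (q : ℂ) : Type := RingQuot (Rel q)

instance (q : ℂ) : Ring (SLq2 q) := inferInstanceAs (Ring (RingQuot (Rel q)))

instance (q : ℂ) : Algebra ℂ (SLq2 q) := inferInstanceAs (Algebra ℂ (RingQuot (Rel q)))

/-- The quotient map from the free algebra onto `A(SL_q(2))`. -/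
def quot (q : ℂ) : FreeAlgebra ℂ Gen →ₐ[ℂ] SLq2 q := RingQuot.mkAlgHom ℂ (Rel q)

theorem quot_rel {q : ℂ} {u v : FreeAlgebra ℂ Gen} (h : Rel q u v) : quot q u = quot q v :=
  RingQuot.mkAlgHom_rel ℂ h

/-- The class of a generator in `A(SL_q(2))`. -/
def gen (q : ℂ) (g : Gen) : SLq2 q := quot q (FreeAlgebra.ι ℂ g)

/-- The generator `a` of `A(SL_q(2))`. -/
def ga (q : ℂ) : SLq2 q := gen q Gen.a

/-- The generator `b` of `A(SL_q(2))`. -/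
def gb (q : ℂ) : SLq2 q := gen q Gen.b

/-- The generator `c` of `A(SL_q(2))`. -/
def gc (q : ℂ) : SLq2 q := gen q Gen.c

/-- The generator `d` of `A(SL_q(2))`. -/
def gd (q : ℂ) : SLq2 q := gen q Gen.d

theorem ga_mul_gb (q : ℂ) : ga q * gb q = q⁻¹ • (gb q * ga q) := by
  simpa [ga, gb, gen] using quot_rel (Rel.ab (q := q))

theorem ga_mul_gc (q : ℂ) : ga q * gc q = q⁻¹ • (gc q * ga q) := by
  simpa [ga, gc, gen] using quot_rel (Rel.ac (q := q))

theorem gb_mul_gd (q : ℂ) : gb q * gd q = q⁻¹ • (gd q * gb q) := by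
  simpa [gb, gd, gen] using quot_rel (Rel.bd (q := q))

theorem gb_mul_gc (q : ℂ) : gb q * gc q = gc q * gb q := by
  simpa [gb, gc, gen] using quot_rel (Rel.bc (q := q))

theorem gc_mul_gd (q : ℂ) : gc q * gd q = q⁻¹ • (gd q * gc q) := by
  simpa [gc, gd, gen] using quot_rel (Rel.cd (q := q))

theorem ga_mul_gd (q : ℂ) : ga q * gd q = 1 + q⁻¹ • (gb q * gc q) := by
  have h := quot_rel (Rel.det_left (q := q))
  simp only [map_sub, map_mul, map_smul, map_one] at h
  exact sub_eq_iff_eq_add.mp h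

theorem gd_mul_ga (q : ℂ) : gd q * ga q = 1 + q • (gb q * gc q) := by
  have h := quot_rel (Rel.det_right (q := q))
  simp only [map_sub, map_mul, map_smul, map_one] at h
  exact sub_eq_iff_eq_add.mp h

/-- The universal property of `A(SL_q(2))`: the algebra homomorphism sending the generators
to given elements `x`, `y`, `z`, `w` that satisfy the defining relations. -/
def lift (q : ℂ) {B : Type*} [Ring B] [Algebra ℂ B] (x y z w : B)
    (hab : x * y = q⁻¹ • (y * x)) (hac : x * z = q⁻¹ • (z * x))
    (hbd : y * w = q⁻¹ • (w * y)) (hbc : y * z = z * y)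
    (hcd : z * w = q⁻¹ • (w * z))
    (had : x * w = 1 + q⁻¹ • (y * z)) (hda : w * x = 1 + q • (y * z)) :
    SLq2 q →ₐ[ℂ] B :=
  RingQuot.liftAlgHom ℂ
    ⟨FreeAlgebra.lift ℂ (fun g => match g with
      | Gen.a => x
      | Gen.b => y
      | Gen.c => z
      | Gen.d => w), by
      intro u v huv
      cases huv with
      | ab => simpa using hab
      | ac => simpa using hac
      | bd => simpa using hbd
      | bc => simpa using hbc
      | cd => simpa using hcd
      | ad_da => simp [had, hda, sub_smul]
      | det_left => simp [had]
      | det_right => simp [hda]⟩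

/-- The right coaction `A(SL_q(2)) → A(SL_q(2)) ⊗ ℂ[z, z⁻¹]`: the algebra homomorphism with
`a ↦ a ⊗ z`, `b ↦ b ⊗ z⁻¹`, `c ↦ c ⊗ z`, `d ↦ d ⊗ z⁻¹`. -/
def coaction (q : ℂ) : SLq2 q →ₐ[ℂ] SLq2 q ⊗[ℂ] ℂ[T;T⁻¹] :=
  lift q (ga q ⊗ₜ LaurentPolynomial.T 1) (gb q ⊗ₜ LaurentPolynomial.T (-1))
    (gc q ⊗ₜ LaurentPolynomial.T 1) (gd q ⊗ₜ LaurentPolynomial.T (-1))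
    (by simp only [Algebra.TensorProduct.tmul_mul_tmul, ga_mul_gb, ← LaurentPolynomial.T_add,
          TensorProduct.smul_tmul', add_comm])
    (by simp only [Algebra.TensorProduct.tmul_mul_tmul, ga_mul_gc, ← LaurentPolynomial.T_add,
          TensorProduct.smul_tmul'])
    (by simp only [Algebra.TensorProduct.tmul_mul_tmul, gb_mul_gd, ← LaurentPolynomial.T_add,
          TensorProduct.smul_tmul'])
    (by simp only [Algebra.TensorProduct.tmul_mul_tmul, gb_mul_gc, ← LaurentPolynomial.T_add,
          add_comm])
    (by simp only [Algebra.TensorProduct.tmul_mul_tmul, gc_mul_gd, ← LaurentPolynomial.T_add,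
          TensorProduct.smul_tmul', add_comm])
    (by simp only [Algebra.TensorProduct.tmul_mul_tmul, ga_mul_gd, ← LaurentPolynomial.T_add,
          TensorProduct.smul_tmul', TensorProduct.add_tmul, Algebra.TensorProduct.one_def,
          add_neg_cancel, neg_add_cancel, LaurentPolynomial.T_zero])
    (by simp only [Algebra.TensorProduct.tmul_mul_tmul, gd_mul_ga, ← LaurentPolynomial.T_add,
          TensorProduct.smul_tmul', TensorProduct.add_tmul, Algebra.TensorProduct.one_def,
          neg_add_cancel, LaurentPolynomial.T_zero])

theorem coaction_ga (q : ℂ) : coaction q (ga q) = ga q ⊗ₜ LaurentPolynomial.T 1 :=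
  (RingQuot.liftAlgHom_mkAlgHom_apply ℂ _ _ _).trans (by simp)

theorem coaction_gb (q : ℂ) : coaction q (gb q) = gb q ⊗ₜ LaurentPolynomial.T (-1) :=
  (RingQuot.liftAlgHom_mkAlgHom_apply ℂ _ _ _).trans (by simp)

theorem coaction_gc (q : ℂ) : coaction q (gc q) = gc q ⊗ₜ LaurentPolynomial.T 1 :=
  (RingQuot.liftAlgHom_mkAlgHom_apply ℂ _ _ _).trans (by simp)

theorem coaction_gd (q : ℂ) : coaction q (gd q) = gd q ⊗ₜ LaurentPolynomial.T (-1) :=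
  (RingQuot.liftAlgHom_mkAlgHom_apply ℂ _ _ _).trans (by simp)

theorem coaction_mul {q : ℂ} {x y : SLq2 q} {m n : ℤ}
    (hx : coaction q x = x ⊗ₜ LaurentPolynomial.T m)
    (hy : coaction q y = y ⊗ₜ LaurentPolynomial.T n) :
    coaction q (x * y) = (x * y) ⊗ₜ LaurentPolynomial.T (m + n) := by
  rw [map_mul, hx, hy, Algebra.TensorProduct.tmul_mul_tmul, LaurentPolynomial.T_add]

theorem coaction_pow {q : ℂ} {x : SLq2 q} {m : ℤ}
    (hx : coaction q x = x ⊗ₜ LaurentPolynomial.T m) (k : ℕ) :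
    coaction q (x ^ k) = (x ^ k) ⊗ₜ LaurentPolynomial.T (k * m) := by
  rw [map_pow, hx, Algebra.TensorProduct.tmul_pow, LaurentPolynomial.T_pow]

theorem coaction_smul {q : ℂ} {x : SLq2 q} {m : ℤ}
    (hx : coaction q x = x ⊗ₜ LaurentPolynomial.T m) (r : ℂ) :
    coaction q (r • x) = (r • x) ⊗ₜ LaurentPolynomial.T m := by
  rw [map_smul, hx, TensorProduct.smul_tmul']

/-- The coordinate algebra `A(S²_q)` of the standard Podleś quantum sphere: the subalgebra of
coinvariants `{p | Δ_R p = p ⊗ 1}` of `A(SL_q(2))`. -/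
def sphere (q : ℂ) : Subalgebra ℂ (SLq2 q) :=
  AlgHom.equalizer (coaction q) Algebra.TensorProduct.includeLeft

theorem mem_sphere {q : ℂ} {p : SLq2 q} : p ∈ sphere q ↔ coaction q p = p ⊗ₜ 1 := Iff.rfl

theorem mem_sphere_of_eq {q : ℂ} {p : SLq2 q} {m : ℤ}
    (hp : coaction q p = p ⊗ₜ LaurentPolynomial.T m) (hm : m = 0) : p ∈ sphere q := by
  rw [mem_sphere, hp, hm, LaurentPolynomial.T_zero]

/-- The element `ab` of `A(S²_q)`. -/
def sab (q : ℂ) : sphere q :=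
  ⟨ga q * gb q, mem_sphere_of_eq (coaction_mul (coaction_ga q) (coaction_gb q)) (by norm_num)⟩

/-- The element `cd` of `A(S²_q)`. -/
def scd (q : ℂ) : sphere q :=
  ⟨gc q * gd q, mem_sphere_of_eq (coaction_mul (coaction_gc q) (coaction_gd q)) (by norm_num)⟩

/-- The element `ζ = -q⁻¹ bc` of `A(S²_q)`. -/
def zeta (q : ℂ) : sphere q :=
  ⟨(-q⁻¹) • (gb q * gc q),
    mem_sphere_of_eq (coaction_smul (coaction_mul (coaction_gb q) (coaction_gc q)) _)
      (by norm_num)⟩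

/-! ### The left projectors -/

/-- The `x`-binomial coefficient
`(x-1)⋯(xⁿ-1) / ((x-1)⋯(xᵏ-1)(x-1)⋯(xⁿ⁻ᵏ-1))`, for `k ≤ n`. -/
def xBinom (x : ℂ) (n k : ℕ) : ℂ :=
  (∏ i ∈ Finset.range n, (x ^ (i + 1) - 1)) /
    ((∏ i ∈ Finset.range k, (x ^ (i + 1) - 1)) *
      ∏ i ∈ Finset.range (n - k), (x ^ (i + 1) - 1))

/-- The entries of the left projector of winding number `-n`, for `n ≥ 0`. -/
def entryNeg (q : ℂ) (n k l : ℕ) : SLq2 q :=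
  ga q ^ (n - k) * gc q ^ k * ((xBinom (q ^ 2) n l * (-q) ^ l) • (gb q ^ l * gd q ^ (n - l)))

/-- The entries of the left projector of winding number `n`, for `n ≥ 0`. -/
def entryPos (q : ℂ) (n k l : ℕ) : SLq2 q :=
  gb q ^ k * gd q ^ (n - k) *
    ((xBinom (q ^ 2) n l * (-q) ^ (-(l : ℤ))) • (ga q ^ (n - l) * gc q ^ l))

theorem entryNeg_mem (q : ℂ) {n k l : ℕ} (hk : k ≤ n) (hl : l ≤ n) :
    entryNeg q n k l ∈ sphere q :=
  mem_sphere_of_eq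
    (coaction_mul
      (coaction_mul (coaction_pow (coaction_ga q) _) (coaction_pow (coaction_gc q) _))
      (coaction_smul
        (coaction_mul (coaction_pow (coaction_gb q) _) (coaction_pow (coaction_gd q) _)) _))
    (by push_cast [hk, hl]; ring)

theorem entryPos_mem (q : ℂ) {n k l : ℕ} (hk : k ≤ n) (hl : l ≤ n) :
    entryPos q n k l ∈ sphere q :=
  mem_sphere_of_eq
    (coaction_mul
      (coaction_mul (coaction_pow (coaction_gb q) _) (coaction_pow (coaction_gd q) _))
      (coaction_smul
        (coaction_mul (coaction_pow (coaction_ga q) _) (coaction_pow (coaction_gc q) _)) _))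
    (by push_cast [hk, hl]; ring)

/-- The left projector matrix `e_μ ∈ M_{|μ|+1}(A(S²_q))` of the quantum Hopf line bundle of
winding number `μ`, with rows and columns indexed by `0, …, |μ|`. -/
def leftProjector (q : ℂ) (μ : ℤ) :
    Matrix (Fin (μ.natAbs + 1)) (Fin (μ.natAbs + 1)) (sphere q) :=
  fun k l =>
    if μ ≤ 0 then
      ⟨entryNeg q μ.natAbs k l,
        entryNeg_mem q (Nat.lt_succ_iff.mp k.isLt) (Nat.lt_succ_iff.mp l.isLt)⟩
    else
      ⟨entryPos q μ.natAbs k l,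
        entryPos_mem q (Nat.lt_succ_iff.mp k.isLt) (Nat.lt_succ_iff.mp l.isLt)⟩

/-! ### The Chern cocycle -/

/-- The vector space with basis the monomials `aⁱ bʲ cᵏ`, `i ∈ ℤ`, `j, k ∈ ℕ`, the underlying
space of `A(SL_q(2))` with the element `a` inverted. -/
abbrev Mon : Type := (ℤ × ℕ × ℕ) →₀ ℂ

/-- Left multiplication by `a` on monomials. -/
def opA : Module.End ℂ Mon :=
  Finsupp.linearCombination ℂ fun p => Finsupp.single (p.1 + 1, p.2.1, p.2.2) 1

/-- Left multiplication by `b` on monomials (`b aⁱ = qⁱ aⁱ b`). -/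
def opB (q : ℂ) : Module.End ℂ Mon :=
  Finsupp.linearCombination ℂ fun p => Finsupp.single (p.1, p.2.1 + 1, p.2.2) (q ^ p.1)

/-- Left multiplication by `c` on monomials (`c aⁱ = qⁱ aⁱ c`). -/
def opC (q : ℂ) : Module.End ℂ Mon :=
  Finsupp.linearCombination ℂ fun p => Finsupp.single (p.1, p.2.1, p.2.2 + 1) (q ^ p.1)

/-- Left multiplication by `d = a⁻¹ (1 + q⁻¹ bc)` on monomials. -/
def opD (q : ℂ) : Module.End ℂ Mon :=
  Finsupp.linearCombination ℂ fun p => Finsupp.single (p.1 - 1, p.2.1, p.2.2) 1 +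
    Finsupp.single (p.1 - 1, p.2.1 + 1, p.2.2 + 1) (q ^ (2 * p.1 - 1))

theorem opA_single (i : ℤ) (j k : ℕ) (r : ℂ) :
    opA (Finsupp.single (i, j, k) r) = Finsupp.single (i + 1, j, k) r := by
  simp [opA]

theorem opB_single (q : ℂ) (i : ℤ) (j k : ℕ) (r : ℂ) :
    opB q (Finsupp.single (i, j, k) r) = Finsupp.single (i, j + 1, k) (r * q ^ i) := by
  simp [opB]

theorem opC_single (q : ℂ) (i : ℤ) (j k : ℕ) (r : ℂ) :
    opC q (Finsupp.single (i, j, k) r) = Finsupp.single (i, j, k + 1) (r * q ^ i) := by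
  simp [opC]

theorem opD_single (q : ℂ) (i : ℤ) (j k : ℕ) (r : ℂ) :
    opD q (Finsupp.single (i, j, k) r) = Finsupp.single (i - 1, j, k) r +
      Finsupp.single (i - 1, j + 1, k + 1) (r * q ^ (2 * i - 1)) := by
  simp [opD]

/-- The action of `A(SL_q(2))` by left multiplication on monomials `aⁱ bʲ cᵏ`. -/
def monRep (q : ℂ) (hq : q ≠ 0) : SLq2 q →ₐ[ℂ] Module.End ℂ Mon :=
  lift q opA (opB q) (opC q) (opD q)
    (by
      refine Finsupp.lhom_ext fun ⟨i, j, k⟩ r => ?_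
      simp only [opA_single, opB_single, Module.End.mul_apply, LinearMap.smul_apply,
        Finsupp.smul_single, smul_eq_mul, zpow_add₀ hq, zpow_one]
      congr 1
      field_simp)
    (by
      refine Finsupp.lhom_ext fun ⟨i, j, k⟩ r => ?_
      simp only [opA_single, opC_single, Module.End.mul_apply, LinearMap.smul_apply,
        Finsupp.smul_single, smul_eq_mul, zpow_add₀ hq, zpow_one]
      congr 1
      field_simp)
    (by
      refine Finsupp.lhom_ext fun ⟨i, j, k⟩ r => ?_
      simp only [opB_single, opD_single, Module.End.mul_apply, LinearMap.smul_apply, map_add,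
        Finsupp.smul_single, smul_eq_mul, smul_add, zpow_sub₀ hq, zpow_one]
      congr 2 <;> field_simp)
    (by
      refine Finsupp.lhom_ext fun ⟨i, j, k⟩ r => ?_
      simp only [opB_single, opC_single, Module.End.mul_apply])
    (by
      refine Finsupp.lhom_ext fun ⟨i, j, k⟩ r => ?_
      simp only [opC_single, opD_single, Module.End.mul_apply, LinearMap.smul_apply, map_add,
        Finsupp.smul_single, smul_eq_mul, smul_add, zpow_sub₀ hq, zpow_one]
      congr 2 <;> field_simp)
    (by
      refine Finsupp.lhom_ext fun ⟨i, j, k⟩ r => ?_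
      simp only [opA_single, opB_single, opC_single, opD_single, Module.End.mul_apply,
        Module.End.one_apply, LinearMap.add_apply, LinearMap.smul_apply, map_add,
        Finsupp.smul_single, smul_eq_mul, sub_add_cancel, zpow_sub₀ hq, zpow_one]
      congr 2
      rw [two_mul, zpow_add₀ hq]
      field_simp)
    (by
      refine Finsupp.lhom_ext fun ⟨i, j, k⟩ r => ?_
      simp only [opA_single, opB_single, opC_single, opD_single, Module.End.mul_apply,
        Module.End.one_apply, LinearMap.add_apply, LinearMap.smul_apply,
        Finsupp.smul_single, smul_eq_mul, add_sub_cancel_right]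
      congr 2
      rw [show 2 * (i + 1) - 1 = i + i + 1 by ring, zpow_add₀ hq, zpow_add₀ hq, zpow_one]
      ring)

theorem monRep_ga (q : ℂ) (hq : q ≠ 0) : monRep q hq (ga q) = opA :=
  (RingQuot.liftAlgHom_mkAlgHom_apply ℂ _ _ _).trans (by simp)

theorem monRep_gb (q : ℂ) (hq : q ≠ 0) : monRep q hq (gb q) = opB q :=
  (RingQuot.liftAlgHom_mkAlgHom_apply ℂ _ _ _).trans (by simp)

theorem monRep_gc (q : ℂ) (hq : q ≠ 0) : monRep q hq (gc q) = opC q :=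
  (RingQuot.liftAlgHom_mkAlgHom_apply ℂ _ _ _).trans (by simp)

theorem monRep_gd (q : ℂ) (hq : q ≠ 0) : monRep q hq (gd q) = opD q :=
  (RingQuot.liftAlgHom_mkAlgHom_apply ℂ _ _ _).trans (by simp)

/-- The linear functional on monomials with `bⁿ cⁿ ↦ (-q)ⁿ (1 - q²ⁿ)⁻¹` for `n > 0` (that is,
`ζⁿ ↦ (1 - q²ⁿ)⁻¹`), which vanishes on all other monomials. -/
def monFunctional (q : ℂ) : Mon →ₗ[ℂ] ℂ :=
  Finsupp.linearCombination ℂ fun p =>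
    if p.1 = 0 ∧ p.2.1 = p.2.2 ∧ 0 < p.2.2 then (-q) ^ p.2.2 * (1 - q ^ (2 * p.2.2))⁻¹ else 0

/-- The Chern cocycle `τ¹` on `A(S²_q)`: expand an element in monomials `aⁱ bʲ cᵏ` and apply
`monFunctional`. By `chernCocycle_spec` and `chernCocycle_unique` it is the linear functional
prescribed by `IsChernCocycle`. -/
def chernCocycle (q : ℂ) (hq : q ≠ 0) : sphere q →ₗ[ℂ] ℂ :=
  monFunctional q ∘ₗ LinearMap.applyₗ (Finsupp.single ((0 : ℤ), (0 : ℕ), (0 : ℕ)) (1 : ℂ)) ∘ₗ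
    (monRep q hq).toLinearMap ∘ₗ (sphere q).val.toLinearMap

/-- The defining values of the Chern cocycle `τ¹` on the basis `(ab)ᵐ ζⁿ`, `(cd)ᵐ ζⁿ` of
`A(S²_q)`. -/
def IsChernCocycle (q : ℂ) (τ : sphere q →ₗ[ℂ] ℂ) : Prop :=
  (∀ m n : ℕ, τ (sab q ^ m * zeta q ^ n) =
    if 0 < n ∧ m = 0 then (1 - q ^ (2 * n))⁻¹ else 0) ∧
  (∀ m n : ℕ, τ (scd q ^ m * zeta q ^ n) =
    if 0 < n ∧ m = 0 then (1 - q ^ (2 * n))⁻¹ else 0)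

theorem chernCocycle_apply (q : ℂ) (hq : q ≠ 0) (x : sphere q) :
    chernCocycle q hq x =
      monFunctional q (monRep q hq x (Finsupp.single ((0 : ℤ), (0 : ℕ), (0 : ℕ)) (1 : ℂ))) := rfl

theorem monFunctional_supported (q : ℂ) {i : ℤ} (hi : i ≠ 0) {v : Mon}
    (hv : v ∈ Finsupp.supported ℂ ℂ {p : ℤ × ℕ × ℕ | p.1 = i}) : monFunctional q v = 0 := by
  rw [monFunctional, Finsupp.linearCombination_apply, Finsupp.sum]
  refine Finset.sum_eq_zero fun p hp => ?_
  have h : p.1 = i := hv hp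
  rw [if_neg (fun h0 => hi (h ▸ h0.1)), smul_zero]

theorem map_supported {f : Module.End ℂ Mon} {i i' : ℤ}
    (hf : ∀ j k r, f (Finsupp.single (i, j, k) r) ∈
      Finsupp.supported ℂ ℂ {p : ℤ × ℕ × ℕ | p.1 = i'}) {v : Mon}
    (hv : v ∈ Finsupp.supported ℂ ℂ {p : ℤ × ℕ × ℕ | p.1 = i}) :
    f v ∈ Finsupp.supported ℂ ℂ {p : ℤ × ℕ × ℕ | p.1 = i'} := by
  rw [← Finsupp.sum_single v, Finsupp.sum, map_sum]
  refine Submodule.sum_mem _ fun p hp => ?_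
  obtain ⟨i₀, j, k⟩ := p
  have h : i₀ = i := hv hp
  subst h
  exact hf j k _

theorem sab_pow_supported (q : ℂ) (hq : q ≠ 0) (m : ℕ) {i : ℤ} {v : Mon}
    (hv : v ∈ Finsupp.supported ℂ ℂ {p : ℤ × ℕ × ℕ | p.1 = i}) :
    monRep q hq ((sab q : SLq2 q) ^ m) v ∈
      Finsupp.supported ℂ ℂ {p : ℤ × ℕ × ℕ | p.1 = i + m} := by
  induction m with
  | zero => simpa using hv
  | succ m ih =>
    rw [pow_succ', map_mul, Module.End.mul_apply]
    refine map_supported (fun j k r => ?_) ih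
    rw [sab, map_mul, monRep_ga, monRep_gb, Module.End.mul_apply, opB_single, opA_single]
    exact Finsupp.single_mem_supported ℂ _ (by simp [add_assoc])

theorem scd_pow_supported (q : ℂ) (hq : q ≠ 0) (m : ℕ) {i : ℤ} {v : Mon}
    (hv : v ∈ Finsupp.supported ℂ ℂ {p : ℤ × ℕ × ℕ | p.1 = i}) :
    monRep q hq ((scd q : SLq2 q) ^ m) v ∈
      Finsupp.supported ℂ ℂ {p : ℤ × ℕ × ℕ | p.1 = i - m} := by
  induction m with
  | zero => simpa using hv
  | succ m ih =>
    rw [pow_succ', map_mul, Module.End.mul_apply]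
    refine map_supported (fun j k r => ?_) ih
    rw [scd, map_mul, monRep_gc, monRep_gd, Module.End.mul_apply, opD_single, map_add,
      opC_single, opC_single]
    refine Submodule.add_mem _ ?_ ?_ <;>
      exact Finsupp.single_mem_supported ℂ _ (by simp; ring)

theorem monRep_zeta_pow (q : ℂ) (hq : q ≠ 0) (n : ℕ) :
    monRep q hq ((zeta q : SLq2 q) ^ n) (Finsupp.single ((0 : ℤ), (0 : ℕ), (0 : ℕ)) (1 : ℂ)) =
      Finsupp.single ((0 : ℤ), n, n) ((-q⁻¹) ^ n) := by
  induction n with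
  | zero => simp
  | succ n ih =>
    rw [pow_succ', map_mul, Module.End.mul_apply, ih, zeta, map_smul, map_mul, monRep_gb,
      monRep_gc, LinearMap.smul_apply, Module.End.mul_apply, opC_single, opB_single,
      Finsupp.smul_single]
    simp [pow_succ']

theorem monFunctional_zeta_pow (q : ℂ) (hq : q ≠ 0) (n : ℕ) :
    monFunctional q (Finsupp.single ((0 : ℤ), n, n) ((-q⁻¹) ^ n)) =
      if 0 < n then (1 - q ^ (2 * n))⁻¹ else 0 := by
  have h : (-q⁻¹) ^ n * (-q) ^ n = 1 := by
    rw [← mul_pow]; simp [hq]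
  by_cases hn : 0 < n
  · simp [monFunctional, hn, ← mul_assoc, h]
  · simp [monFunctional, hn]

/-- The functional `chernCocycle` has the defining values of the Chern cocycle. -/
theorem chernCocycle_spec (q : ℂ) (hq : q ≠ 0) : IsChernCocycle q (chernCocycle q hq) := by
  have hz (n : ℕ) : Finsupp.single ((0 : ℤ), n, n) ((-q⁻¹) ^ n) ∈
      Finsupp.supported ℂ ℂ {p : ℤ × ℕ × ℕ | p.1 = 0} :=
    Finsupp.single_mem_supported ℂ _ (by simp)
  refine ⟨fun m n => ?_, fun m n => ?_⟩
  · rw [chernCocycle_apply, MulMemClass.coe_mul, SubmonoidClass.coe_pow, SubmonoidClass.coe_pow,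
      map_mul, Module.End.mul_apply, monRep_zeta_pow]
    rcases Nat.eq_zero_or_pos m with rfl | hm
    · simp [monFunctional_zeta_pow q hq]
    · rw [monFunctional_supported q (i := 0 + m) (by simpa using hm.ne')
        (sab_pow_supported q hq m (hz n)), if_neg (fun h => hm.ne' h.2)]
  · rw [chernCocycle_apply, MulMemClass.coe_mul, SubmonoidClass.coe_pow, SubmonoidClass.coe_pow,
      map_mul, Module.End.mul_apply, monRep_zeta_pow]
    rcases Nat.eq_zero_or_pos m with rfl | hm
    · simp [monFunctional_zeta_pow q hq]
    · rw [monFunctional_supported q (i := 0 - m) (by simpa using hm.ne')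
        (scd_pow_supported q hq m (hz n)), if_neg (fun h => hm.ne' h.2)]

/-! ### The Chern cocycle is determined by its defining values -/

/-- The monomials `aⁱ bʲ cᵏ` and `dⁱ bʲ cᵏ`. -/
def pbw (q : ℂ) : Set (SLq2 q) :=
  {x | ∃ i j k : ℕ, x = ga q ^ i * (gb q ^ j * gc q ^ k) ∨ x = gd q ^ i * (gb q ^ j * gc q ^ k)}

theorem mul_pow_of_mul_eq {A : Type*} [Ring A] [Algebra ℂ A] {x y : A} {s : ℂ}
    (h : y * x = s • (x * y)) (i : ℕ) : y * x ^ i = s ^ i • (x ^ i * y) := by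
  induction i with
  | zero => simp
  | succ i ih =>
    rw [pow_succ, ← mul_assoc, ih, smul_mul_assoc, mul_assoc, h, mul_smul_comm, smul_smul,
      pow_succ, mul_assoc]

theorem gb_mul_ga (q : ℂ) (hq : q ≠ 0) : gb q * ga q = q • (ga q * gb q) := by
  rw [ga_mul_gb, smul_smul, mul_inv_cancel₀ hq, one_smul]

theorem gc_mul_ga (q : ℂ) (hq : q ≠ 0) : gc q * ga q = q • (ga q * gc q) := by
  rw [ga_mul_gc, smul_smul, mul_inv_cancel₀ hq, one_smul]

theorem gb_mul_mem (q : ℂ) (hq : q ≠ 0) {x : SLq2 q} (hx : x ∈ Submodule.span ℂ (pbw q)) :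
    gb q * x ∈ Submodule.span ℂ (pbw q) := by
  induction hx using Submodule.span_induction with
  | zero => simp
  | add x y _ _ hx hy => rw [mul_add]; exact Submodule.add_mem _ hx hy
  | smul r x _ hx => rw [mul_smul_comm]; exact Submodule.smul_mem _ r hx
  | mem x hx =>
    obtain ⟨i, j, k, rfl | rfl⟩ := hx
    · rw [← mul_assoc, mul_pow_of_mul_eq (gb_mul_ga q hq), smul_mul_assoc, mul_assoc,
        ← mul_assoc (gb q), ← pow_succ']
      exact Submodule.smul_mem _ _ (Submodule.subset_span ⟨i, j + 1, k, Or.inl rfl⟩)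
    · rw [← mul_assoc, mul_pow_of_mul_eq (gb_mul_gd q), smul_mul_assoc, mul_assoc,
        ← mul_assoc (gb q), ← pow_succ']
      exact Submodule.smul_mem _ _ (Submodule.subset_span ⟨i, j + 1, k, Or.inr rfl⟩)

theorem gc_mul_mem (q : ℂ) (hq : q ≠ 0) {x : SLq2 q} (hx : x ∈ Submodule.span ℂ (pbw q)) :
    gc q * x ∈ Submodule.span ℂ (pbw q) := by
  have hcb (j k : ℕ) : gc q * (gb q ^ j * gc q ^ k) = gb q ^ j * gc q ^ (k + 1) := by
    have h : Commute (gc q) (gb q ^ j) := Commute.pow_right (gb_mul_gc q).symm j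
    rw [← mul_assoc, h.eq, mul_assoc, ← pow_succ']
  induction hx using Submodule.span_induction with
  | zero => simp
  | add x y _ _ hx hy => rw [mul_add]; exact Submodule.add_mem _ hx hy
  | smul r x _ hx => rw [mul_smul_comm]; exact Submodule.smul_mem _ r hx
  | mem x hx =>
    obtain ⟨i, j, k, rfl | rfl⟩ := hx
    · rw [← mul_assoc, mul_pow_of_mul_eq (gc_mul_ga q hq), smul_mul_assoc, mul_assoc, hcb]
      exact Submodule.smul_mem _ _ (Submodule.subset_span ⟨i, j, k + 1, Or.inl rfl⟩)
    · rw [← mul_assoc, mul_pow_of_mul_eq (gc_mul_gd q), smul_mul_assoc, mul_assoc, hcb]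
      exact Submodule.smul_mem _ _ (Submodule.subset_span ⟨i, j, k + 1, Or.inr rfl⟩)

theorem ga_mul_mem (q : ℂ) (hq : q ≠ 0) {x : SLq2 q} (hx : x ∈ Submodule.span ℂ (pbw q)) :
    ga q * x ∈ Submodule.span ℂ (pbw q) := by
  induction hx using Submodule.span_induction with
  | zero => simp
  | add x y _ _ hx hy => rw [mul_add]; exact Submodule.add_mem _ hx hy
  | smul r x _ hx => rw [mul_smul_comm]; exact Submodule.smul_mem _ r hx
  | mem x hx =>
    obtain ⟨i, j, k, rfl | rfl⟩ := hx
    · rw [← mul_assoc, ← pow_succ']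
      exact Submodule.subset_span ⟨i + 1, j, k, Or.inl rfl⟩
    · rcases i with _ | i
      · rw [pow_zero, one_mul]
        exact Submodule.subset_span ⟨1, j, k, Or.inl (by rw [pow_one])⟩
      · have hm : gd q ^ i * (gb q ^ j * gc q ^ k) ∈ Submodule.span ℂ (pbw q) :=
          Submodule.subset_span ⟨i, j, k, Or.inr rfl⟩
        rw [pow_succ', mul_assoc, ← mul_assoc (ga q), ga_mul_gd, add_mul, one_mul,
          smul_mul_assoc, mul_assoc]
        exact Submodule.add_mem _ hm
          (Submodule.smul_mem _ _ (gb_mul_mem q hq (gc_mul_mem q hq hm)))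

theorem gd_mul_mem (q : ℂ) (hq : q ≠ 0) {x : SLq2 q} (hx : x ∈ Submodule.span ℂ (pbw q)) :
    gd q * x ∈ Submodule.span ℂ (pbw q) := by
  induction hx using Submodule.span_induction with
  | zero => simp
  | add x y _ _ hx hy => rw [mul_add]; exact Submodule.add_mem _ hx hy
  | smul r x _ hx => rw [mul_smul_comm]; exact Submodule.smul_mem _ r hx
  | mem x hx =>
    obtain ⟨i, j, k, rfl | rfl⟩ := hx
    · rcases i with _ | i
      · rw [pow_zero, one_mul]
        exact Submodule.subset_span ⟨1, j, k, Or.inr (by rw [pow_one])⟩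
      · have hm : ga q ^ i * (gb q ^ j * gc q ^ k) ∈ Submodule.span ℂ (pbw q) :=
          Submodule.subset_span ⟨i, j, k, Or.inl rfl⟩
        rw [pow_succ', mul_assoc, ← mul_assoc (gd q), gd_mul_ga, add_mul, one_mul,
          smul_mul_assoc, mul_assoc]
        exact Submodule.add_mem _ hm
          (Submodule.smul_mem _ _ (gb_mul_mem q hq (gc_mul_mem q hq hm)))
    · rw [← mul_assoc, ← pow_succ']
      exact Submodule.subset_span ⟨i + 1, j, k, Or.inr rfl⟩

theorem span_pbw (q : ℂ) (hq : q ≠ 0) (x : SLq2 q) : x ∈ Submodule.span ℂ (pbw q) := by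
  obtain ⟨u, rfl⟩ := RingQuot.mkAlgHom_surjective ℂ (Rel q) x
  have h : ∀ y ∈ Submodule.span ℂ (pbw q), quot q u * y ∈ Submodule.span ℂ (pbw q) := by
    induction u using FreeAlgebra.induction with
    | grade0 r =>
      intro y hy
      rw [AlgHom.commutes, ← Algebra.smul_def]
      exact Submodule.smul_mem _ r hy
    | grade1 g =>
      intro y hy
      cases g with
      | a => exact ga_mul_mem q hq hy
      | b => exact gb_mul_mem q hq hy
      | c => exact gc_mul_mem q hq hy
      | d => exact gd_mul_mem q hq hy
    | mul u v hu hv =>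
      intro y hy
      rw [map_mul, mul_assoc]
      exact hu _ (hv _ hy)
    | add u v hu hv =>
      intro y hy
      rw [map_add, add_mul]
      exact Submodule.add_mem _ (hu _ hy) (hv _ hy)
  have h1 := h 1 (Submodule.subset_span ⟨0, 0, 0, Or.inl (by simp)⟩)
  rwa [mul_one] at h1

/-- The projection of `A(SL_q(2))` onto the coinvariants along the other homogeneous
components. -/
def coinvProj (q : ℂ) : SLq2 q →ₗ[ℂ] SLq2 q :=
  (TensorProduct.rid ℂ (SLq2 q)).toLinearMap ∘ₗ
    LinearMap.lTensor (SLq2 q)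
      (Finsupp.lapply (0 : ℤ) ∘ₗ (AddMonoidAlgebra.coeffLinearEquiv ℂ).toLinearMap) ∘ₗ
      (coaction q).toLinearMap

theorem coinvProj_of_eq {q : ℂ} {x : SLq2 q} {m : ℤ}
    (hx : coaction q x = x ⊗ₜ LaurentPolynomial.T m) :
    coinvProj q x = if m = 0 then x else 0 := by
  have h : coinvProj q x = (LaurentPolynomial.T m : ℂ[T;T⁻¹]).coeff 0 • x := by
    simp only [coinvProj, LinearMap.comp_apply, AlgHom.toLinearMap_apply, hx,
      LinearMap.lTensor_tmul]
    exact TensorProduct.rid_tmul _ _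
  rw [h, LaurentPolynomial.T_apply]
  split_ifs <;> simp

/-- The elements `(ab)ᵐ ζⁿ` and `(cd)ᵐ ζⁿ` of `A(S²_q)`. -/
def sphereMonomials (q : ℂ) : Set (sphere q) :=
  {x | ∃ m n : ℕ, x = sab q ^ m * zeta q ^ n ∨ x = scd q ^ m * zeta q ^ n}

theorem exists_pow_mul_pow {A : Type*} [Ring A] [Algebra ℂ A] {x y : A} {s : ℂ} (hs : s ≠ 0)
    (h : y * x = s • (x * y)) (i : ℕ) : ∃ t : ℂ, x ^ i * y ^ i = t • (x * y) ^ i := by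
  induction i with
  | zero => exact ⟨1, by simp⟩
  | succ i ih =>
    obtain ⟨t, ht⟩ := ih
    have h1 : x ^ i * y = (s ^ i)⁻¹ • (y * x ^ i) := by
      rw [mul_pow_of_mul_eq h, smul_smul, inv_mul_cancel₀ (pow_ne_zero i hs), one_smul]
    refine ⟨(s ^ i)⁻¹ * t, ?_⟩
    calc x ^ (i + 1) * y ^ (i + 1) = x * (x ^ i * y) * y ^ i := by
          rw [pow_succ', pow_succ']; simp only [mul_assoc]
      _ = (s ^ i)⁻¹ • ((x * y) * (x ^ i * y ^ i)) := by
          rw [h1, mul_smul_comm, smul_mul_assoc]; simp only [mul_assoc]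
      _ = ((s ^ i)⁻¹ * t) • (x * y) ^ (i + 1) := by
          rw [ht, mul_smul_comm, smul_smul, ← pow_succ']

theorem gb_pow_mul_gc_pow (q : ℂ) (hq : q ≠ 0) (n : ℕ) :
    gb q ^ n * gc q ^ n = (-q) ^ n • (zeta q : SLq2 q) ^ n := by
  rw [← smul_pow, zeta, smul_smul, neg_mul_neg, mul_inv_cancel₀ hq, one_smul,
    (show Commute (gb q) (gc q) from gb_mul_gc q).mul_pow]

theorem ga_monomial_mem (q : ℂ) (hq : q ≠ 0) (i k : ℕ) :
    ga q ^ i * (gb q ^ (i + k) * gc q ^ k) ∈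
      Submodule.span ℂ (Subtype.val '' sphereMonomials q) := by
  obtain ⟨t, ht⟩ := exists_pow_mul_pow hq (gb_mul_ga q hq) i
  have h : ga q ^ i * (gb q ^ (i + k) * gc q ^ k) =
      (t * (-q) ^ k) • (((sab q ^ i * zeta q ^ k : sphere q)) : SLq2 q) := by
    rw [pow_add, mul_assoc, gb_pow_mul_gc_pow q hq, ← mul_assoc, ht, mul_smul_comm,
      smul_mul_assoc, smul_smul, mul_comm ((-q) ^ k)]
    rfl
  rw [h]
  exact Submodule.smul_mem _ _ (Submodule.subset_span ⟨_, ⟨i, k, Or.inl rfl⟩, rfl⟩)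

theorem gd_monomial_mem (q : ℂ) (hq : q ≠ 0) (i j : ℕ) :
    gd q ^ i * (gb q ^ j * gc q ^ (i + j)) ∈
      Submodule.span ℂ (Subtype.val '' sphereMonomials q) := by
  have hdc : gd q * gc q = q • (gc q * gd q) := by
    rw [gc_mul_gd, smul_smul, mul_inv_cancel₀ hq, one_smul]
  have hcd : gc q * gd q ^ i = q⁻¹ ^ i • (gd q ^ i * gc q) := mul_pow_of_mul_eq (gc_mul_gd q) i
  obtain ⟨t, ht⟩ := exists_pow_mul_pow hq hdc i
  have hcomm : ∃ s : ℂ, gd q ^ i * gc q ^ i = s • (gc q ^ i * gd q ^ i) := by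
    have h2 : gd q ^ i * gc q = q ^ i • (gc q * gd q ^ i) := by
      rw [hcd, smul_smul, ← mul_pow, mul_inv_cancel₀ hq, one_pow, one_smul]
    exact ⟨_, mul_pow_of_mul_eq h2 i⟩
  obtain ⟨s, hs⟩ := hcomm
  have hbc : gb q ^ j * gc q ^ i = gc q ^ i * gb q ^ j :=
    ((show Commute (gb q) (gc q) from gb_mul_gc q).pow_pow j i).eq
  have h : gd q ^ i * (gb q ^ j * gc q ^ (i + j)) =
      (s * t * (-q) ^ j) • (((scd q ^ i * zeta q ^ j : sphere q)) : SLq2 q) := by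
    rw [pow_add, ← mul_assoc (gb q ^ j), hbc, mul_assoc, ← mul_assoc, gb_pow_mul_gc_pow q hq,
      hs, ht, mul_smul_comm, smul_smul, smul_mul_assoc, smul_smul, mul_comm ((-q) ^ j)]
    rfl
  rw [h]
  exact Submodule.smul_mem _ _ (Submodule.subset_span ⟨_, ⟨i, j, Or.inr rfl⟩, rfl⟩)

theorem coinvProj_mem (q : ℂ) (hq : q ≠ 0) (x : SLq2 q) :
    coinvProj q x ∈ Submodule.span ℂ (Subtype.val '' sphereMonomials q) := by
  induction span_pbw q hq x using Submodule.span_induction with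
  | zero => simp
  | add x y _ _ hx hy => rw [map_add]; exact Submodule.add_mem _ hx hy
  | smul r x _ hx => rw [map_smul]; exact Submodule.smul_mem _ r hx
  | mem x hx =>
    obtain ⟨i, j, k, rfl | rfl⟩ := hx
    · rw [coinvProj_of_eq (coaction_mul (coaction_pow (coaction_ga q) i)
        (coaction_mul (coaction_pow (coaction_gb q) j) (coaction_pow (coaction_gc q) k)))]
      split_ifs with h
      · obtain rfl : j = i + k := by omega
        exact ga_monomial_mem q hq i k
      · exact Submodule.zero_mem _
    · rw [coinvProj_of_eq (coaction_mul (coaction_pow (coaction_gd q) i)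
        (coaction_mul (coaction_pow (coaction_gb q) j) (coaction_pow (coaction_gc q) k)))]
      split_ifs with h
      · obtain rfl : k = i + j := by omega
        exact gd_monomial_mem q hq i j
      · exact Submodule.zero_mem _

theorem span_sphereMonomials (q : ℂ) (hq : q ≠ 0) :
    Submodule.span ℂ (sphereMonomials q) = ⊤ := by
  refine Submodule.eq_top_iff'.mpr fun x => ?_
  have hx : coaction q x = (x : SLq2 q) ⊗ₜ LaurentPolynomial.T 0 := by
    rw [LaurentPolynomial.T_zero]; exact mem_sphere.mp x.2
  have h := coinvProj_mem q hq x
  rw [coinvProj_of_eq hx, if_pos rfl] at h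
  have e : Submodule.span ℂ (Subtype.val '' sphereMonomials q) =
      (Submodule.span ℂ (sphereMonomials q)).map (sphere q).val.toLinearMap :=
    (Submodule.map_span (sphere q).val.toLinearMap (sphereMonomials q)).symm
  rw [e] at h
  obtain ⟨y, hy, hyx⟩ := h
  rwa [← Subtype.ext hyx]

/-- The Chern cocycle is the only linear functional with its defining values. -/
theorem chernCocycle_unique (q : ℂ) (hq : q ≠ 0) {τ : sphere q →ₗ[ℂ] ℂ}
    (hτ : IsChernCocycle q τ) : τ = chernCocycle q hq := by
  refine LinearMap.ext_on (span_sphereMonomials q hq) ?_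
  have h0 := chernCocycle_spec q hq
  rintro x ⟨m, n, rfl | rfl⟩
  · rw [hτ.1, h0.1]
  · rw [hτ.2, h0.2]

end QuantumSphere

end

/-! Put `x = q ^ 2` and `n = |μ|`. Every diagonal entry of `e_μ` is a polynomial in `ζ`, so only the
values of `τ¹` on powers of `ζ` matter. They define a functional `L` on `ℂ[X]` with `L 1 = 0` and `L
(X ^ n) = (1 - x ^ n)⁻¹` for `n > 0`.

Since `ad = 1 - ζ`, `da = 1 - xζ`, `aζ = x⁻¹ζa` and `dζ = xζd`, the products `a ^ m * d ^ m` and `d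
^ m * a ^ m` become `∏ (1 - x⁻ⁱ ζ)` and `∏ (1 - xⁱ⁺¹ ζ)` over `i < m`
(`pow_mul_pow_eq_aeval_shiftedProd`). The two families of entries then take the form `entryNeg_self`
and `entryPos_self`.

For `|x| < 1` and `p(0) = 0`, expanding the geometric series gives `L p = ∑ p(xʳ)` over `r ≥ 0`, a
Jackson integral. So `L` of `X ^ k` times such a product is a `q`-beta value when `k ≥ 1`, which the
`x`-binomial of the entry cancels down to one fraction with denominator `x ^ k - 1`. The entry `k =
0` contributes instead a sum of `n` fractions with these same denominators. Paired by denominator,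
the fractions add up to `-1` each for `μ ≤ 0` and to `1` each for `μ > 0`, whence the total `μ`
(`sum_xBinom_mul_map_inv`, `sum_xBinom_mul_map_self`). -/

namespace QuantumSphere

open Polynomial

/-! ### Shifted products and `x`-factorials -/

/-- The product `(1 - s X)(1 - s t X)⋯(1 - s tᵐ⁻¹ X)`. -/
noncomputable def shiftedProd (s t : ℂ) (m : ℕ) : ℂ[X] := ∏ i ∈ Finset.range m, (1 - C (s * t ^ i) * X)

theorem shiftedProd_zero (s t : ℂ) : shiftedProd s t 0 = 1 := by simp [shiftedProd]

theorem shiftedProd_succ (s t : ℂ) (m : ℕ) :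
    shiftedProd s t (m + 1) = shiftedProd s t m * (1 - C (s * t ^ m) * X) :=
  Finset.prod_range_succ _ _

/-- The product `(x - 1)(x² - 1)⋯(xᵐ - 1)`. -/
noncomputable def xFactorial (x : ℂ) (m : ℕ) : ℂ := ∏ i ∈ Finset.range m, (x ^ (i + 1) - 1)

theorem xFactorial_zero (x : ℂ) : xFactorial x 0 = 1 := by simp [xFactorial]

theorem xFactorial_succ (x : ℂ) (m : ℕ) :
    xFactorial x (m + 1) = xFactorial x m * (x ^ (m + 1) - 1) :=
  Finset.prod_range_succ _ _

theorem xFactorial_ne_zero {x : ℂ} (hx : ∀ n : ℕ, 0 < n → x ^ n ≠ 1) (m : ℕ) :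
    xFactorial x m ≠ 0 :=
  Finset.prod_ne_zero_iff.mpr fun i _ => sub_ne_zero.mpr (hx (i + 1) i.succ_pos)

theorem xBinom_eq (x : ℂ) (n k : ℕ) :
    xBinom x n k = xFactorial x n / (xFactorial x k * xFactorial x (n - k)) := rfl

theorem xBinom_zero {x : ℂ} (hx : ∀ n : ℕ, 0 < n → x ^ n ≠ 1) (n : ℕ) : xBinom x n 0 = 1 := by
  rw [xBinom_eq, xFactorial_zero, one_mul, Nat.sub_zero, div_self (xFactorial_ne_zero hx n)]

/-! ### Values of the functional on shifted products -/

section Functional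

variable {x : ℂ} {L : ℂ[X] →ₗ[ℂ] ℂ}

theorem map_X_pow_mul_shiftedProd_succ (L : ℂ[X] →ₗ[ℂ] ℂ) (s t : ℂ) (k m : ℕ) :
    L (X ^ k * shiftedProd s t (m + 1)) =
      L (X ^ k * shiftedProd s t m) - s * t ^ m * L (X ^ (k + 1) * shiftedProd s t m) := by
  have h : X ^ k * shiftedProd s t (m + 1) =
      X ^ k * shiftedProd s t m - (s * t ^ m) • (X ^ (k + 1) * shiftedProd s t m) := by
    rw [shiftedProd_succ, smul_eq_C_mul]; ring
  rw [h, map_sub, map_smul, smul_eq_mul]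

/-- A `q`-beta evaluation. The recurrence in `m` raises the exponent of `X`, so the induction must
keep `j` free. The step rests on `(x ^ (j+m+2) - 1) - (x ^ (j+1) - 1) = x ^ (j+1) * (x ^ (m+1) -
1)`. The exponent `j + 1` excludes the constant term, where `L` does not follow the pattern `(1 - x
^ n)⁻¹`. -/
theorem map_X_pow_mul_shiftedProd_inv (hx0 : x ≠ 0) (hx : ∀ n : ℕ, 0 < n → x ^ n ≠ 1)
    (hL : ∀ n : ℕ, L (X ^ (n + 1)) = (1 - x ^ (n + 1))⁻¹) (m : ℕ) : ∀ j : ℕ,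
    L (X ^ (j + 1) * shiftedProd 1 x⁻¹ m) =
      -(x ^ ((j + 1) * m) * xFactorial x m * xFactorial x j / xFactorial x (j + m + 1)) := by
  have hne (n : ℕ) : x ^ (n + 1) - 1 ≠ 0 := sub_ne_zero.mpr (hx _ n.succ_pos)
  induction m with
  | zero =>
    intro j
    have := hne j
    have := xFactorial_ne_zero hx j
    rw [shiftedProd_zero, mul_one, hL, add_zero, xFactorial_succ, ← neg_sub, inv_neg,
      xFactorial_zero]
    simp only [mul_zero, pow_zero, one_mul]
    field_simp
  | succ m ih =>
    intro j
    have h1 := xFactorial_ne_zero hx (j + m + 1)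
    have h2 := hne (j + m + 1)
    rw [map_X_pow_mul_shiftedProd_succ, ih, ih, show j + 1 + m + 1 = j + m + 1 + 1 by ring,
      show j + (m + 1) + 1 = j + m + 1 + 1 by ring, xFactorial_succ x (j + m + 1),
      xFactorial_succ x j, xFactorial_succ x m, one_mul, inv_pow]
    field_simp
    ring

/-- Same induction, now with `(x ^ (j+m+2) - 1) - x ^ (m+1) * (x ^ (j+1) - 1) = x ^ (m+1) - 1`, so
no power of `x` accumulates. -/
theorem map_X_pow_mul_shiftedProd_self (hx : ∀ n : ℕ, 0 < n → x ^ n ≠ 1)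
    (hL : ∀ n : ℕ, L (X ^ (n + 1)) = (1 - x ^ (n + 1))⁻¹) (m : ℕ) : ∀ j : ℕ,
    L (X ^ (j + 1) * shiftedProd x x m) =
      -(xFactorial x m * xFactorial x j / xFactorial x (j + m + 1)) := by
  have hne (n : ℕ) : x ^ (n + 1) - 1 ≠ 0 := sub_ne_zero.mpr (hx _ n.succ_pos)
  induction m with
  | zero =>
    intro j
    have := hne j
    have := xFactorial_ne_zero hx j
    rw [shiftedProd_zero, mul_one, hL, add_zero, xFactorial_succ, ← neg_sub, inv_neg,
      xFactorial_zero]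
    field_simp
  | succ m ih =>
    intro j
    have h1 := xFactorial_ne_zero hx (j + m + 1)
    have h2 := hne (j + m + 1)
    rw [map_X_pow_mul_shiftedProd_succ, ih, ih, show j + 1 + m + 1 = j + m + 1 + 1 by ring,
      show j + (m + 1) + 1 = j + m + 1 + 1 by ring, xFactorial_succ x (j + m + 1),
      xFactorial_succ x j, xFactorial_succ x m]
    field_simp
    ring

/-- The exponent zero escapes the beta formula. Each new factor of the product changes the value by
a multiple of the beta value at `j = 0`, so the result telescopes to a sum starting from `L 1 = 0`.
-/
theorem map_shiftedProd_inv (hx0 : x ≠ 0) (hx : ∀ n : ℕ, 0 < n → x ^ n ≠ 1) (hL0 : L 1 = 0)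
    (hL : ∀ n : ℕ, L (X ^ (n + 1)) = (1 - x ^ (n + 1))⁻¹) (m : ℕ) :
    L (shiftedProd 1 x⁻¹ m) = ∑ j ∈ Finset.range m, (x ^ (j + 1) - 1)⁻¹ := by
  induction m with
  | zero => simpa [shiftedProd_zero] using hL0
  | succ m ih =>
    have h := map_X_pow_mul_shiftedProd_succ L 1 x⁻¹ 0 m
    have h1 := xFactorial_ne_zero hx m
    have h2 : x ^ (m + 1) - 1 ≠ 0 := sub_ne_zero.mpr (hx _ m.succ_pos)
    -- The added term is `x⁻ᵐ * xᵐ / (x ^ (m+1) - 1)`: the weight `x⁻ᵐ` of the new factor cancels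
    -- the power in the beta value.
    rw [pow_zero, one_mul, one_mul, ih, map_X_pow_mul_shiftedProd_inv hx0 hx hL, xFactorial_zero,
      zero_add, zero_add, xFactorial_succ] at h
    rw [h, Finset.sum_range_succ, one_mul, mul_one, one_mul, inv_pow]
    field_simp
    ring

theorem map_shiftedProd_self (hx : ∀ n : ℕ, 0 < n → x ^ n ≠ 1) (hL0 : L 1 = 0)
    (hL : ∀ n : ℕ, L (X ^ (n + 1)) = (1 - x ^ (n + 1))⁻¹) (m : ℕ) :
    L (shiftedProd x x m) = ∑ j ∈ Finset.range m, x ^ (j + 1) * (x ^ (j + 1) - 1)⁻¹ := by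
  induction m with
  | zero => simpa [shiftedProd_zero] using hL0
  | succ m ih =>
    have h := map_X_pow_mul_shiftedProd_succ L x x 0 m
    have h1 := xFactorial_ne_zero hx m
    have h2 : x ^ (m + 1) - 1 ≠ 0 := sub_ne_zero.mpr (hx _ m.succ_pos)
    rw [pow_zero, one_mul, one_mul, ih, map_X_pow_mul_shiftedProd_self hx hL, xFactorial_zero,
      zero_add, xFactorial_succ] at h
    rw [h, Finset.sum_range_succ]
    field_simp
    ring

/-- This is the trace computation for `μ ≤ 0`. The weights are the scalars that appear in
`entryNeg_self`. -/
theorem sum_xBinom_mul_map_inv (hx0 : x ≠ 0) (hx : ∀ n : ℕ, 0 < n → x ^ n ≠ 1) (hL0 : L 1 = 0)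
    (hL : ∀ n : ℕ, L (X ^ (n + 1)) = (1 - x ^ (n + 1))⁻¹) (n : ℕ) :
    ∑ k ∈ Finset.range (n + 1), xBinom x n k * x ^ k * x⁻¹ ^ ((n - k) * k) *
      L (X ^ k * shiftedProd 1 x⁻¹ (n - k)) = -n := by
  have hne (n : ℕ) : x ^ (n + 1) - 1 ≠ 0 := sub_ne_zero.mpr (hx _ n.succ_pos)
  have hterm : ∀ j ∈ Finset.range n, xBinom x n (j + 1) * x ^ (j + 1) *
      x⁻¹ ^ ((n - (j + 1)) * (j + 1)) * L (X ^ (j + 1) * shiftedProd 1 x⁻¹ (n - (j + 1))) =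
      -(x ^ (j + 1) * (x ^ (j + 1) - 1)⁻¹) := by
    intro j hj
    -- With `k = j + 1`, writing `n = j + m + 1` makes `m = n - k`. The binomial then cancels all
    -- factorials except the last factor `x ^ (j+1) - 1`.
    obtain ⟨m, rfl⟩ := Nat.exists_eq_add_of_lt (Finset.mem_range.mp hj)
    have h1 := xFactorial_ne_zero hx (j + m + 1)
    have h2 := xFactorial_ne_zero hx m
    have h3 := xFactorial_ne_zero hx j
    have h4 := hne j
    rw [xBinom_eq, show j + m + 1 - (j + 1) = m by omega,
      map_X_pow_mul_shiftedProd_inv hx0 hx hL, xFactorial_succ x j, mul_comm m, inv_pow]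
    field_simp
  rw [Finset.sum_range_succ', Finset.sum_congr rfl hterm, xBinom_zero hx, pow_zero, mul_zero,
    pow_zero, pow_zero, one_mul, one_mul, one_mul, one_mul, Nat.sub_zero,
    map_shiftedProd_inv hx0 hx hL0 hL, ← Finset.sum_add_distrib]
  -- The entry `k = j + 1` pairs with the `j`-th summand of the entry `k = 0`: `(1 - x ^ (j+1)) / (x
  -- ^ (j+1) - 1) = -1`.
  rw [Finset.sum_congr rfl (g := fun _ => (-1 : ℂ))]
  · simp
  · intro j _
    have := hne j
    field_simp
    ring

/-- The counterpart for `μ > 0`. The numerator `x ^ (j+1)` now sits in the entry `k = 0`, so each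
pair gives `1`. -/
theorem sum_xBinom_mul_map_self (hx : ∀ n : ℕ, 0 < n → x ^ n ≠ 1) (hL0 : L 1 = 0)
    (hL : ∀ n : ℕ, L (X ^ (n + 1)) = (1 - x ^ (n + 1))⁻¹) (n : ℕ) :
    ∑ k ∈ Finset.range (n + 1), xBinom x n k * L (X ^ k * shiftedProd x x (n - k)) = n := by
  have hne (n : ℕ) : x ^ (n + 1) - 1 ≠ 0 := sub_ne_zero.mpr (hx _ n.succ_pos)
  have hterm : ∀ j ∈ Finset.range n, xBinom x n (j + 1) *
      L (X ^ (j + 1) * shiftedProd x x (n - (j + 1))) = -(x ^ (j + 1) - 1)⁻¹ := by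
    intro j hj
    obtain ⟨m, rfl⟩ := Nat.exists_eq_add_of_lt (Finset.mem_range.mp hj)
    have h1 := xFactorial_ne_zero hx (j + m + 1)
    have h2 := xFactorial_ne_zero hx m
    have h3 := xFactorial_ne_zero hx j
    have h4 := hne j
    rw [xBinom_eq, show j + m + 1 - (j + 1) = m by omega,
      map_X_pow_mul_shiftedProd_self hx hL, xFactorial_succ x j]
    field_simp
  rw [Finset.sum_range_succ', Finset.sum_congr rfl hterm, xBinom_zero hx, pow_zero, one_mul,
    one_mul, Nat.sub_zero, map_shiftedProd_self hx hL0 hL, ← Finset.sum_add_distrib]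
  rw [Finset.sum_congr rfl (g := fun _ => (1 : ℂ))]
  · simp
  · intro j _
    have := hne j
    field_simp
    ring

end Functional

/-! ### Reordering under twisted commutation -/

section Algebra

variable {A : Type*} [Ring A] [Algebra ℂ A] {u v z : A} {s t : ℂ}

theorem pow_mul_pow_of_mul_eq (h : u * z = t • (z * u)) (m k : ℕ) :
    u ^ m * z ^ k = t ^ (m * k) • (z ^ k * u ^ m) := by
  induction m with
  | zero => simp
  | succ m ih =>
    rw [pow_succ', mul_assoc, ih, mul_smul_comm, ← mul_assoc, mul_pow_of_mul_eq h, smul_mul_assoc,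
      smul_smul, mul_assoc, ← pow_add, Nat.succ_mul]

/-- Replacing the innermost `u * v` by `1 - s • z` and moving `z` left through `u ^ m` produces the
factor `1 - s * t ^ m • z`. -/
theorem pow_mul_pow_eq_aeval_shiftedProd (huv : u * v = 1 - s • z) (huz : u * z = t • (z * u))
    (m : ℕ) : u ^ m * v ^ m = aeval z (shiftedProd s t m) := by
  induction m with
  | zero => simp [shiftedProd_zero]
  | succ m ih =>
    have h := pow_mul_pow_of_mul_eq huz m 1
    rw [pow_one, mul_one] at h
    calc u ^ (m + 1) * v ^ (m + 1) = u ^ m * (u * v) * v ^ m := by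
          rw [pow_succ, pow_succ']; simp only [mul_assoc]
      _ = (1 - (s * t ^ m) • z) * (u ^ m * v ^ m) := by
          rw [huv, mul_sub, mul_smul_comm, h, smul_smul, mul_one, sub_mul, sub_mul, one_mul,
            smul_mul_assoc, smul_mul_assoc, mul_assoc]
      _ = aeval z (shiftedProd s t (m + 1)) := by
          rw [ih, shiftedProd_succ, mul_comm (shiftedProd s t m), map_mul]
          simp [Algebra.smul_def]

end Algebra

/-! ### Diagonal entries as polynomials in `ζ` -/

theorem coe_zeta (q : ℂ) : (zeta q : SLq2 q) = (-q⁻¹) • (gb q * gc q) := rfl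

theorem gb_mul_gc_eq (q : ℂ) (hq : q ≠ 0) : gb q * gc q = (-q) • (zeta q : SLq2 q) := by
  simpa using gb_pow_mul_gc_pow q hq 1

theorem ga_mul_zeta (q : ℂ) :
    ga q * (zeta q : SLq2 q) = (q ^ 2)⁻¹ • ((zeta q : SLq2 q) * ga q) := by
  rw [coe_zeta, mul_smul_comm, smul_mul_assoc, ← mul_assoc, ga_mul_gb, smul_mul_assoc, mul_assoc,
    ga_mul_gc, mul_smul_comm, smul_smul, smul_comm, ← mul_assoc, sq, mul_inv, smul_smul]
  rw [smul_smul]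
  congr 1
  ring

theorem gd_mul_zeta (q : ℂ) (hq : q ≠ 0) :
    gd q * (zeta q : SLq2 q) = q ^ 2 • ((zeta q : SLq2 q) * gd q) := by
  have hb : gd q * gb q = q • (gb q * gd q) := by
    rw [gb_mul_gd, smul_smul, mul_inv_cancel₀ hq, one_smul]
  have hc : gd q * gc q = q • (gc q * gd q) := by
    rw [gc_mul_gd, smul_smul, mul_inv_cancel₀ hq, one_smul]
  rw [coe_zeta, mul_smul_comm, smul_mul_assoc, ← mul_assoc, hb, smul_mul_assoc, mul_assoc,
    hc, mul_smul_comm, smul_smul, smul_smul, ← mul_assoc, smul_smul]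
  congr 1
  ring

theorem ga_pow_mul_gd_pow (q : ℂ) (hq : q ≠ 0) (m : ℕ) :
    ga q ^ m * gd q ^ m = aeval (zeta q : SLq2 q) (shiftedProd 1 (q ^ 2)⁻¹ m) := by
  refine pow_mul_pow_eq_aeval_shiftedProd ?_ (ga_mul_zeta q) m
  rw [ga_mul_gd, gb_mul_gc_eq q hq, smul_smul, mul_neg, inv_mul_cancel₀ hq, neg_smul,
    sub_eq_add_neg]

theorem gd_pow_mul_ga_pow (q : ℂ) (hq : q ≠ 0) (m : ℕ) :
    gd q ^ m * ga q ^ m = aeval (zeta q : SLq2 q) (shiftedProd (q ^ 2) (q ^ 2) m) := by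
  refine pow_mul_pow_eq_aeval_shiftedProd ?_ (gd_mul_zeta q hq) m
  rw [gd_mul_ga, gb_mul_gc_eq q hq, smul_smul, mul_neg, neg_smul, sub_eq_add_neg, sq]

/-- The middle factor `c ^ k * b ^ k` is `(-q) ^ k • ζ ^ k`, which with the scalar `(-q) ^ k` of the
entry yields `(q ^ 2) ^ k`. Moving `ζ ^ k` left past `a ^ (n - k)` costs `(q ^ 2)⁻¹ ^ ((n - k) *
k)`. -/
theorem entryNeg_self (q : ℂ) (hq : q ≠ 0) (n k : ℕ) :
    entryNeg q n k k = (xBinom (q ^ 2) n k * (q ^ 2) ^ k * (q ^ 2)⁻¹ ^ ((n - k) * k)) •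
      aeval (zeta q : SLq2 q) (X ^ k * shiftedProd 1 (q ^ 2)⁻¹ (n - k)) := by
  have hcb : gc q ^ k * gb q ^ k = (-q) ^ k • (zeta q : SLq2 q) ^ k := by
    rw [← gb_pow_mul_gc_pow q hq,
      ((show Commute (gb q) (gc q) from gb_mul_gc q).pow_pow k k).eq]
  calc entryNeg q n k k = (xBinom (q ^ 2) n k * (-q) ^ k) •
        (ga q ^ (n - k) * (gc q ^ k * gb q ^ k) * gd q ^ (n - k)) := by
        rw [entryNeg, mul_smul_comm]; simp only [mul_assoc]
    _ = _ := by
        rw [hcb, mul_smul_comm, pow_mul_pow_of_mul_eq (ga_mul_zeta q), smul_mul_assoc,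
          smul_mul_assoc, mul_assoc, ga_pow_mul_gd_pow q hq, map_mul, map_pow, aeval_X, smul_smul,
          smul_smul]
        congr 1
        rw [show (q ^ 2) ^ k = (-q) ^ k * (-q) ^ k by rw [← mul_pow]; ring]
        ring

/-- Here the inner product `d ^ (n - k) * a ^ (n - k)` is a polynomial in `ζ` and commutes with `c`.
Hence `c ^ k` moves to `b ^ k` for free, and the resulting `(-q) ^ k` cancels the scalar of the
entry. -/
theorem entryPos_self (q : ℂ) (hq : q ≠ 0) (n k : ℕ) :
    entryPos q n k k = xBinom (q ^ 2) n k •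
      aeval (zeta q : SLq2 q) (X ^ k * shiftedProd (q ^ 2) (q ^ 2) (n - k)) := by
  have hcz : Commute (gc q) (zeta q : SLq2 q) :=
    (Commute.mul_right (gb_mul_gc q).symm (Commute.refl _)).smul_right _
  have hcp (p : ℂ[X]) : Commute (gc q ^ k) (aeval (zeta q : SLq2 q) p) := by
    refine Commute.pow_left ?_ k
    induction p using Polynomial.induction_on' with
    | add p r hp hr => rw [map_add]; exact hp.add_right hr
    | monomial i r =>
      rw [aeval_monomial]
      exact Commute.mul_right (Algebra.commutes r (gc q)).symm (hcz.pow_right i)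
  calc entryPos q n k k = (xBinom (q ^ 2) n k * (-q) ^ (-(k : ℤ))) •
        (gb q ^ k * (gd q ^ (n - k) * ga q ^ (n - k) * gc q ^ k)) := by
        rw [entryPos, mul_smul_comm]; simp only [mul_assoc]
    _ = _ := by
        rw [gd_pow_mul_ga_pow q hq, ← (hcp _).eq, ← mul_assoc, gb_pow_mul_gc_pow q hq,
          smul_mul_assoc, smul_smul, map_mul, map_pow, aeval_X, zpow_neg, zpow_natCast, mul_assoc,
          inv_mul_cancel₀ (pow_ne_zero k (neg_ne_zero.mpr hq)), mul_one]

/-! ### The cocycle on the trace -/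

theorem coe_aeval_zeta (q : ℂ) (p : ℂ[X]) :
    ((aeval (zeta q) p : sphere q) : SLq2 q) = aeval (zeta q : SLq2 q) p :=
  (aeval_algHom_apply (sphere q).val (zeta q) p).symm

theorem chernCocycle_zeta_pow (q : ℂ) (hq : q ≠ 0) (n : ℕ) :
    chernCocycle q hq (zeta q ^ n) = if 0 < n then (1 - (q ^ 2) ^ n)⁻¹ else 0 := by
  simpa [pow_mul] using (chernCocycle_spec q hq).1 0 n

theorem chernCocycle_trace_leftProjector (q : ℂ) (hq : q ≠ 0)
    (hroot : ∀ n : ℕ, 0 < n → q ^ n ≠ 1) (μ : ℤ) :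
    chernCocycle q hq (Matrix.trace (leftProjector q μ)) = (μ : ℂ) := by
  have hx (n : ℕ) (hn : 0 < n) : (q ^ 2) ^ n ≠ 1 := by
    rw [← pow_mul]; exact hroot _ (by omega)
  -- Only the values of the cocycle on powers of `ζ` enter `L`. Its case `n = 0` supplies `L 1 = 0`.
  let L : ℂ[X] →ₗ[ℂ] ℂ := chernCocycle q hq ∘ₗ (aeval (zeta q)).toLinearMap
  have hL0 : L 1 = 0 := by simpa [L] using chernCocycle_zeta_pow q hq 0
  have hL (n : ℕ) : L (X ^ (n + 1)) = (1 - (q ^ 2) ^ (n + 1))⁻¹ := by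
    simpa [L] using chernCocycle_zeta_pow q hq (n + 1)
  rw [Matrix.trace, map_sum]
  rcases le_or_gt μ 0 with hμ | hμ
  · have h (k : Fin (μ.natAbs + 1)) : chernCocycle q hq ((leftProjector q μ).diag k) =
        xBinom (q ^ 2) μ.natAbs k * (q ^ 2) ^ (k : ℕ) * (q ^ 2)⁻¹ ^ ((μ.natAbs - k) * k) *
          L (X ^ (k : ℕ) * shiftedProd 1 (q ^ 2)⁻¹ (μ.natAbs - k)) := by
      -- With the scalar inside `L`, both sides are the cocycle at an element of the sphere, and
      -- these elements can be compared in `SLq2 q`.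
      rw [← smul_eq_mul, ← map_smul L]
      refine congrArg (chernCocycle q hq) (Subtype.ext ?_)
      rw [Matrix.diag_apply, leftProjector, if_pos hμ, AlgHom.toLinearMap_apply, coe_aeval_zeta,
        map_smul]
      exact entryNeg_self q hq _ _
    rw [Finset.sum_congr rfl fun k _ => h k, Fin.sum_univ_eq_sum_range (fun k =>
        xBinom (q ^ 2) μ.natAbs k * (q ^ 2) ^ k * (q ^ 2)⁻¹ ^ ((μ.natAbs - k) * k) *
          L (X ^ k * shiftedProd 1 (q ^ 2)⁻¹ (μ.natAbs - k))),
      sum_xBinom_mul_map_inv (pow_ne_zero 2 hq) hx hL0 hL, Nat.cast_natAbs, abs_of_nonpos hμ]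
    simp
  · have h (k : Fin (μ.natAbs + 1)) : chernCocycle q hq ((leftProjector q μ).diag k) =
        xBinom (q ^ 2) μ.natAbs k *
          L (X ^ (k : ℕ) * shiftedProd (q ^ 2) (q ^ 2) (μ.natAbs - k)) := by
      rw [← smul_eq_mul, ← map_smul L]
      refine congrArg (chernCocycle q hq) (Subtype.ext ?_)
      rw [Matrix.diag_apply, leftProjector, if_neg hμ.not_ge, AlgHom.toLinearMap_apply,
        coe_aeval_zeta, map_smul]
      exact entryPos_self q hq _ _
    rw [Finset.sum_congr rfl fun k _ => h k, Fin.sum_univ_eq_sum_range (fun k =>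
        xBinom (q ^ 2) μ.natAbs k * L (X ^ k * shiftedProd (q ^ 2) (q ^ 2) (μ.natAbs - k))),
      sum_xBinom_mul_map_self hx hL0 hL, Nat.cast_natAbs, abs_of_pos hμ]

end QuantumSphere

/-- For every integer `μ`, the Chern cocycle `τ¹` of the standard Podleś quantum sphere, applied
to the trace of the left projector `e_μ` of the quantum Hopf line bundle of winding number `μ`,
equals `μ`. -/
theorem theorem2p1 (q : ℂ) (hq : q ≠ 0) (hroot : ∀ n : ℕ, 0 < n → q ^ n ≠ 1) (μ : ℤ) :
    QuantumSphere.chernCocycle q hq (Matrix.trace (QuantumSphere.leftProjector q μ)) = (μ : ℂ) :=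
  QuantumSphere.chernCocycle_trace_leftProjector q hq hroot μ
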